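/- Let $M$ be a smooth manifold (finite-dimensional, without boundary, Hausdorff, $\sigma$-compact), and let $\mathbf TM=TM\oplus T^*M$ carry the neutral metric $g((X,\alpha),(Y,\mu))=\alpha(Y)+\mu(X)$ and the Courant bracket $$[(X,\alpha),(Y,\mu)]=\bigl([X,Y],\,L_X\mu-L_Y\alpha+\tfrac12 d(\alpha(Y)-\mu(X))\bigr).$$ Let $\tau$ be a generalized 2-nilpotent structure on $M$, that is, a smooth endomorphism $\tau$ of $\mathbf TM$ of constant rank with $\tau^2=0$ and $g(\mathcal X,\tau\mathcal Y)+g(\tau\mathcal X,\mathcal Y)=0$. Put $E=\operatorname{im}\tau$, and let $E^{\perp_g}$ be its $g$-orthogonal bundle; it equals $\ker\tau$. Put $\tilde E=\mathbf TM/E^{\perp_g}$, and let $\tau':\tilde E\to E$ be the isomorphism induced by $\tau$. The structure $\tau$ is *integrable* if $$\mathcal N_\tau(\mathcal X,\mathcal Y)=[\tau\mathcal X,\tau\mathcal Y]-\tau[\mathcal X,\tau\mathcal Y]-\tau[\tau\mathcal X,\mathcal Y]+\tau^2[\mathcal X,\mathcal Y]$$ vanishes for all $\mathcal X,\mathcal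 Y\in\Gamma\mathbf TM$, and *weakly integrable* if $\Gamma E$ is closed under the Courant bracket. Put $[\mathcal X,\mathcal Y]_\tau=[\tau\mathcal X,\mathcal Y]+[\mathcal X,\tau\mathcal Y]$. 1. If $\tau$ is weakly integrable, then $[\mathcal X_{\mathrm{mod}\,E^{\perp_g}},\mathcal Y_{\mathrm{mod}\,E^{\perp_g}}]_\tau=([\mathcal X,\mathcal Y]_\tau)_{\mathrm{mod}\,E^{\perp_g}}$ is a well-defined bracket on $\Gamma\tilde E$, the *induced $\tau$-bracket*. 2. If $\tau$ is integrable, then $\tau$ is weakly integrable; $\tilde E$ with the induced $\tau$-bracket and the anchor $pr_{TM}\circ\tau'$ is a Lie algebroid; $E$ with the Courant bracket and the anchor $pr_{TM}|_E$ is a Lie algebroid; and $\tau':\tilde E\to E$ is an isomorphism of Lie algebroids. 3. If $\tau$ is weakly integrable, then $\tau$ is integrable if and only if the induced $\tau$-bracket is equal to the bracket $[s,t]_{\tilde E}=\tau'^{-1}[\tau's,\tau't]$ on $\Gamma\tilde E$. -/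

import Mathlib

open scoped Bundle Manifold ContDiff Topology

namespace BigTangent

noncomputable section

section BigTangentBundle

variable {E : Type*} [NormedAddCommGroup E] [NormedSpace ℝ E]
  {H : Type*} [TopologicalSpace H]

/-- The cotangent space `T*ₓM`; by Mathlib's instances it is the fibre of a smooth bundle. -/
abbrev CotangentSpace (I : ModelWithCorners ℝ E H) {M : Type*} [TopologicalSpace M]
    [ChartedSpace H M] (x : M) : Type _ :=
  TangentSpace I x →L[ℝ] ℝ

/-- The fibre at `x` of the big tangent bundle `𝐓M = TM ⊕ T*M`. The bundle structure is Mathlib's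
direct sum of vector bundles. -/
abbrev BigTangentSpace (I : ModelWithCorners ℝ E H) {M : Type*} [TopologicalSpace M]
    [ChartedSpace H M] (x : M) : Type _ :=
  TangentSpace I x × CotangentSpace I x

/-- The model fibre of the big tangent bundle. -/
abbrev BigModel (E : Type*) [NormedAddCommGroup E] [NormedSpace ℝ E] : Type _ :=
  E × (E →L[ℝ] ℝ)

/-- The total space of the big tangent bundle. -/
abbrev BigTotalSpace (I : ModelWithCorners ℝ E H) (M : Type*) [TopologicalSpace M]
    [ChartedSpace H M] : Type _ :=
  Bundle.TotalSpace (BigModel E) (fun x : M ↦ BigTangentSpace I x)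

/-- The neutral metric `g((X, α), (Y, μ)) = α(Y) + μ(X)` on the fibre at `x`. -/
def neutralMetric (I : ModelWithCorners ℝ E H) {M : Type*} [TopologicalSpace M]
    [ChartedSpace H M] (x : M) : LinearMap.BilinForm ℝ (BigTangentSpace I x) :=
  LinearMap.mk₂ ℝ (fun v w ↦ v.2 w.1 + w.2 v.1)
    (by intro v v' w; simp; ring) (by intro c v w; simp; ring)
    (by intro v w w'; simp; ring) (by intro c v w; simp; ring)

variable (I : ModelWithCorners ℝ E H) (M : Type*) [TopologicalSpace M] [ChartedSpace H M]
  [IsManifold I ∞ M]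

/-- Smooth vector fields. -/
abbrev VectorFields : Type _ := Cₛ^∞⟮I; E, fun x : M ↦ TangentSpace I x⟯

/-- Smooth differential `1`-forms. -/
abbrev OneForms : Type _ := Cₛ^∞⟮I; E →L[ℝ] ℝ, fun x : M ↦ CotangentSpace I x⟯

/-- `Γ 𝐓M`: smooth sections of the big tangent bundle. -/
abbrev BigSections : Type _ := Cₛ^∞⟮I; BigModel E, fun x : M ↦ BigTangentSpace I x⟯

variable {I M}

/-- The vector field `X` of a section `(X, α)` of the big tangent bundle. -/
def BigSections.vec (X : BigSections I M) : VectorFields I M where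
  toFun x := (X x).1
  contMDiff_toFun := by
    intro x
    have h := X.contMDiff x
    rw [Bundle.contMDiffAt_section] at h ⊢
    exact (contDiff_fst.contMDiff (f := (Prod.fst : BigModel E → E))).contMDiffAt.comp x h

/-- The `1`-form `α` of a section `(X, α)` of the big tangent bundle. -/
def BigSections.form (X : BigSections I M) : OneForms I M where
  toFun x := (X x).2
  contMDiff_toFun := by
    intro x
    have h := X.contMDiff x
    rw [Bundle.contMDiffAt_section] at h ⊢
    exact (contDiff_snd.contMDiff (f := (Prod.snd : BigModel E → _))).contMDiffAt.comp x h

/-! ### The Lie derivative of a 1-form and the Courant bracket -/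

/-- The expression `X(μ(Z)) - μ([X, Z])` at the point `x`, as a function of the vector field `Z`. -/
def lieDerivativeOn (X : Π x : M, TangentSpace I x) (μ : Π x : M, CotangentSpace I x) (x : M)
    (Z : Π x : M, TangentSpace I x) : ℝ :=
  mvfderiv I (fun y ↦ μ y (Z y)) x (X x) - μ x (VectorField.mlieBracket I X Z x)

variable [FiniteDimensional ℝ E]

theorem tensorialAt_lieDerivativeOn (X : VectorFields I M) (μ : OneForms I M) (x : M) :
    TensorialAt I E (lieDerivativeOn (I := I) X μ x) x := by
  have : CompleteSpace E := FiniteDimensional.complete ℝ E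
  have key : ∀ {Z : Π x : M, TangentSpace I x}, MDiffAt (T% Z) x →
      MDiffAt (fun y ↦ μ y (Z y)) x := by
    intro Z hZ
    have h1 := (μ.contMDiff x).mdifferentiableAt (by simp)
    have h2 := MDifferentiableAt.clm_bundle_apply (F₂ := ℝ) (E₂ := fun _ : M ↦ ℝ) h1 hZ
    exact (mdifferentiableAt_section (F := ℝ) I _).1 h2
  constructor
  · intro f Z hf hZ
    have h1 : (fun y ↦ μ y ((f • Z) y)) = f • fun y ↦ μ y (Z y) := by
      ext y; simp
    unfold lieDerivativeOn
    rw [VectorField.mlieBracket_smul_right hf hZ, h1, mvfderiv_smul hf (key hZ)]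
    simp
    ring
  · intro Z Z' hZ hZ'
    have h1 : (fun y ↦ μ y ((Z + Z') y)) = (fun y ↦ μ y (Z y)) + fun y ↦ μ y (Z' y) := by
      ext y; simp
    unfold lieDerivativeOn
    rw [VectorField.mlieBracket_add_right hZ hZ', h1, mvfderiv_add (key hZ) (key hZ')]
    simp
    ring

/-- The Lie derivative `L_X μ` of a `1`-form: the covector at `x` characterized by
`(L_X μ)(Z) = X(μ(Z)) - μ([X, Z])` for all vector fields `Z`. -/
def lieDerivative (X : VectorFields I M) (μ : OneForms I M) (x : M) : CotangentSpace I x :=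
  TensorialAt.mkHom (lieDerivativeOn (I := I) X μ x) x (tensorialAt_lieDerivativeOn X μ x)

theorem lieDerivative_apply (X : VectorFields I M) (μ : OneForms I M) (x : M)
    (Z : VectorFields I M) :
    lieDerivative X μ x (Z x) =
      mvfderiv I (fun y ↦ μ y (Z y)) x (X x) - μ x (VectorField.mlieBracket I X Z x) :=
  TensorialAt.mkHom_apply (tensorialAt_lieDerivativeOn X μ x)
    ((Z.contMDiff x).mdifferentiableAt (by simp))

/-- The Courant bracket
`[(X, α), (Y, μ)] = ([X, Y], L_X μ - L_Y α + (1/2) d(α(Y) - μ(X)))`. -/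
def courantBracket (X Y : BigSections I M) (x : M) : BigTangentSpace I x :=
  (VectorField.mlieBracket I X.vec Y.vec x,
    lieDerivative X.vec Y.form x - lieDerivative Y.vec X.form x
      + (1 / 2 : ℝ) • mvfderiv I (fun y ↦ X.form y (Y.vec y) - Y.form y (X.vec y)) x)

end BigTangentBundle

/-! ### Vector bundles through their smooth sections, and Lie algebroids -/

section LieAlgebroids

variable {E : Type*} [NormedAddCommGroup E] [NormedSpace ℝ E]
  {H : Type*} [TopologicalSpace H] (I : ModelWithCorners ℝ E H)
  {M : Type*} [TopologicalSpace M] [ChartedSpace H M] [IsManifold I ∞ M]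
  {V : M → Type*} [∀ x, AddCommGroup (V x)] [∀ x, Module ℝ (V x)]
  {V' : M → Type*} [∀ x, AddCommGroup (V' x)] [∀ x, Module ℝ (V' x)]

/-- The family of vector spaces `V x`, `x ∈ M`, is a smooth vector bundle (of constant finite rank)
with `Γ` as its space of smooth sections: `Γ` is a `C^∞(M)`-module, being in `Γ` is a local
condition, and near every point there is a frame of elements of `Γ` in which the elements of `Γ`
have smooth coefficients. -/
structure IsSmoothVectorBundle (Γ : Submodule ℝ (Π x : M, V x)) : Prop where
  smul_mem : ∀ (f : C^∞⟮I, M; ℝ⟯) (s : Π x : M, V x), s ∈ Γ → (fun x ↦ f x • s x) ∈ Γ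
  mem_of_locally : ∀ s : Π x : M, V x,
    (∀ x₀ : M, ∃ t ∈ Γ, ∀ᶠ x in 𝓝 x₀, s x = t x) → s ∈ Γ
  exists_frame : ∃ k : ℕ, ∀ x₀ : M, ∃ e : Fin k → Π x : M, V x,
    (∀ i, e i ∈ Γ) ∧
    (∀ᶠ x in 𝓝 x₀, LinearIndependent ℝ (fun i ↦ e i x) ∧
      Submodule.span ℝ (Set.range fun i ↦ e i x) = ⊤) ∧
    ∀ s ∈ Γ, ∃ f : Fin k → C^∞⟮I, M; ℝ⟯, ∀ᶠ x in 𝓝 x₀, s x = ∑ i, f i x • e i x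

/-- The bundle `V` with smooth sections `Γ`, the bracket `br` on `Γ` and the anchor
`ρ : V → TM` is a Lie algebroid over `M`. -/
structure IsLieAlgebroid (Γ : Submodule ℝ (Π x : M, V x)) (br : Γ → Γ → Π x : M, V x)
    (ρ : Π x : M, V x →ₗ[ℝ] TangentSpace I x) : Prop where
  isSmoothVectorBundle : IsSmoothVectorBundle I Γ
  anchor_smooth : ∀ s : Γ, ContMDiff I (I.prod 𝓘(ℝ, E)) ∞
    (fun x ↦ Bundle.TotalSpace.mk' E (E := fun x : M ↦ TangentSpace I x) x (ρ x (s.1 x)))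
  bracket_mem : ∀ s t : Γ, br s t ∈ Γ
  bracket_add : ∀ s t u : Γ, br s (t + u) = br s t + br s u
  bracket_smul : ∀ (c : ℝ) (s t : Γ), br s (c • t) = c • br s t
  bracket_skew : ∀ s t : Γ, br s t = -br t s
  jacobi : ∀ s t u : Γ,
    br s ⟨br t u, bracket_mem t u⟩ + br t ⟨br u s, bracket_mem u s⟩
      + br u ⟨br s t, bracket_mem s t⟩ = 0
  leibniz : ∀ (s t : Γ) (f : C^∞⟮I, M; ℝ⟯) (x : M),
    br s ⟨fun y ↦ f y • t.1 y, isSmoothVectorBundle.smul_mem f t.1 t.2⟩ x =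
      f x • br s t x + mvfderiv I f x (ρ x (s.1 x)) • t.1 x
  anchor_bracket : ∀ (s t : Γ) (x : M),
    ρ x (br s t x) =
      VectorField.mlieBracket I (fun y ↦ ρ y (s.1 y)) (fun y ↦ ρ y (t.1 y)) x

/-- The fibrewise linear isomorphisms `φ x : V x ≃ V' x` form an isomorphism of vector bundles (they
identify the smooth sections) that intertwines the anchors and the brackets. -/
structure IsLieAlgebroidIso (Γ : Submodule ℝ (Π x : M, V x)) (br : Γ → Γ → Π x : M, V x)
    (ρ : Π x : M, V x →ₗ[ℝ] TangentSpace I x)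
    (Γ' : Submodule ℝ (Π x : M, V' x)) (br' : Γ' → Γ' → Π x : M, V' x)
    (ρ' : Π x : M, V' x →ₗ[ℝ] TangentSpace I x) (φ : Π x : M, V x ≃ₗ[ℝ] V' x) : Prop where
  mem_iff : ∀ s : Π x : M, V x, s ∈ Γ ↔ (fun x ↦ φ x (s x)) ∈ Γ'
  map_anchor : ∀ (x : M) (v : V x), ρ' x (φ x v) = ρ x v
  map_bracket : ∀ (s t : Γ) (x : M),
    φ x (br s t x) = br' ⟨fun y ↦ φ y (s.1 y), (mem_iff s.1).1 s.2⟩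
      ⟨fun y ↦ φ y (t.1 y), (mem_iff t.1).1 t.2⟩ x

end LieAlgebroids

/-! ### Generalized 2-nilpotent structures -/

section TwoNilpotent

variable {E : Type*} [NormedAddCommGroup E] [NormedSpace ℝ E]
  {H : Type*} [TopologicalSpace H]

/-- A generalized 2-nilpotent structure: a smooth endomorphism `τ` of the big tangent bundle, of
constant rank, `g`-skew-symmetric and with `τ² = 0`. -/
structure TwoNilpotentStructure (I : ModelWithCorners ℝ E H) (M : Type*) [TopologicalSpace M]
    [ChartedSpace H M] [IsManifold I ∞ M] where
  toFun : Π x : M, BigTangentSpace I x →ₗ[ℝ] BigTangentSpace I x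
  contMDiff_toFun : ContMDiff (I.prod 𝓘(ℝ, BigModel E)) (I.prod 𝓘(ℝ, BigModel E)) ∞
    (fun p : BigTotalSpace I M ↦ (⟨p.1, toFun p.1 p.2⟩ : BigTotalSpace I M))
  sq_zero : ∀ (x : M) (v : BigTangentSpace I x), toFun x (toFun x v) = 0
  skew : ∀ (x : M) (v w : BigTangentSpace I x),
    neutralMetric I x v (toFun x w) + neutralMetric I x (toFun x v) w = 0
  const_rank : ∃ r : ℕ, ∀ x : M, Module.finrank ℝ (LinearMap.range (toFun x)) = r

variable {I : ModelWithCorners ℝ E H} {M : Type*} [TopologicalSpace M] [ChartedSpace H M]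
  [IsManifold I ∞ M]

namespace TwoNilpotentStructure

variable (τ : TwoNilpotentStructure I M)

/-- The section `τ 𝒳` of the big tangent bundle. -/
def apply (X : BigSections I M) : BigSections I M where
  toFun x := τ.toFun x (X x)
  contMDiff_toFun := τ.contMDiff_toFun.comp X.contMDiff

/-- The fibre `Eₓ ⊆ 𝐓ₓM` of `E = im τ`, as a subspace. -/
abbrev image (x : M) : Submodule ℝ (BigTangentSpace I x) := LinearMap.range (τ.toFun x)

/-- The fibre `Eₓ` of `E = im τ`, as a vector space. -/
def Image (x : M) : Type _ := τ.image x

instance (x : M) : AddCommGroup (τ.Image x) := inferInstanceAs (AddCommGroup (τ.image x))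

instance (x : M) : Module ℝ (τ.Image x) := inferInstanceAs (Module ℝ (τ.image x))

/-- The inclusion of `Eₓ` in `𝐓ₓM`. -/
def incl (x : M) : τ.Image x →ₗ[ℝ] BigTangentSpace I x := (τ.image x).subtype

/-- The fibre at `x` of the `g`-orthogonal bundle of `E`. -/
def perp (x : M) : Submodule ℝ (BigTangentSpace I x) :=
  (neutralMetric I x).orthogonal (τ.image x)

/-- The fibre at `x` of `Ẽ = 𝐓M / E^⊥`. -/
def Quot (x : M) : Type _ := BigTangentSpace I x ⧸ τ.perp x

instance (x : M) : AddCommGroup (τ.Quot x) :=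
  inferInstanceAs (AddCommGroup (BigTangentSpace I x ⧸ τ.perp x))

instance (x : M) : Module ℝ (τ.Quot x) :=
  inferInstanceAs (Module ℝ (BigTangentSpace I x ⧸ τ.perp x))

/-- The projection `v ↦ v mod Eₓ^⊥` of `𝐓ₓM` on `Ẽₓ`. -/
def proj (x : M) : BigTangentSpace I x →ₗ[ℝ] τ.Quot x := (τ.perp x).mkQ

/-- `Γ E`: the sections of `E` which are smooth as sections of the big tangent bundle. -/
def imageSections : Submodule ℝ (Π x : M, τ.Image x) where
  carrier := {s | ContMDiff I (I.prod 𝓘(ℝ, BigModel E)) ∞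
    (fun x ↦ (⟨x, τ.incl x (s x)⟩ : BigTotalSpace I M))}
  add_mem' hs ht := ContMDiff.add_section hs ht
  zero_mem' := Bundle.contMDiff_zeroSection ℝ (fun x : M ↦ BigTangentSpace I x)
  smul_mem' _ _ hs := ContMDiff.const_smul_section hs

/-- A section of `E` seen as a section of the big tangent bundle. -/
def ofImage (s : τ.imageSections) : BigSections I M := ⟨fun x ↦ τ.incl x (s.1 x), s.2⟩

/-- `Γ Ẽ`: the sections of `Ẽ` which near every point are the class of a smooth section of the
big tangent bundle. -/
def quotSections : Submodule ℝ (Π x : M, τ.Quot x) where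
  carrier := {s | ∀ x₀ : M, ∃ X : BigSections I M,
    ∀ᶠ x in 𝓝 x₀, s x = τ.proj x (X x)}
  add_mem' := by
    intro s t hs ht x₀
    obtain ⟨X, hX⟩ := hs x₀
    obtain ⟨Y, hY⟩ := ht x₀
    refine ⟨X + Y, ?_⟩
    filter_upwards [hX, hY] with x h1 h2
    simp [h1, h2]
  zero_mem' := fun x₀ ↦ ⟨0, Filter.Eventually.of_forall fun x ↦ by simp⟩
  smul_mem' := by
    intro c s hs x₀
    obtain ⟨X, hX⟩ := hs x₀
    refine ⟨c • X, ?_⟩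
    filter_upwards [hX] with x h1
    simp [h1]

/-- The section `𝒳 mod E^⊥` of `Ẽ`. -/
def mkQuot (X : BigSections I M) : τ.quotSections :=
  ⟨fun x ↦ τ.proj x (X x), fun _ ↦ ⟨X, Filter.Eventually.of_forall fun _ ↦ rfl⟩⟩

theorem mem_perp_iff (x : M) (v : BigTangentSpace I x) :
    v ∈ τ.perp x ↔ ∀ w, neutralMetric I x (τ.toFun x w) v = 0 := by
  refine ⟨fun h w ↦ h _ ⟨w, rfl⟩, ?_⟩
  rintro h _ ⟨w, rfl⟩
  exact h w

theorem perp_eq_ker (x : M) : τ.perp x = LinearMap.ker (τ.toFun x) := by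
  ext v
  rw [mem_perp_iff, LinearMap.mem_ker]
  have h : ∀ w, neutralMetric I x (τ.toFun x w) v = - neutralMetric I x w (τ.toFun x v) := by
    intro w
    linarith [τ.skew x w v]
  constructor
  · intro hv
    have h0 : ∀ w, neutralMetric I x w (τ.toFun x v) = 0 := by
      intro w
      have h1 := h w
      rw [hv w] at h1
      linarith
    refine Prod.ext ?_ ?_
    · by_contra hne
      obtain ⟨f, hf⟩ := SeparatingDual.exists_ne_zero (R := ℝ) (V := E) hne
      have h1 : f (τ.toFun x v).1 + (τ.toFun x v).2 0 = 0 := h0 (0, f)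
      rw [map_zero, add_zero] at h1
      exact hf h1
    · ext z
      simpa [neutralMetric] using h0 (z, 0)
  · intro hv w
    rw [h w, hv]
    simp

/-- The isomorphism `τ' : Ẽ → E` induced by `τ`. -/
def tauPrime (x : M) : τ.Quot x ≃ₗ[ℝ] τ.Image x :=
  (Submodule.quotEquivOfEq _ _ (τ.perp_eq_ker x)).trans (τ.toFun x).quotKerEquivRange

theorem tauPrime_mk (x : M) (v : BigTangentSpace I x) :
    τ.incl x (τ.tauPrime x (τ.proj x v)) = τ.toFun x v := rfl

/-- The section `τ' s` of `E`, for a section `s` of `Ẽ`. -/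
def tauPrimeSection (s : τ.quotSections) : τ.imageSections :=
  ⟨fun x ↦ τ.tauPrime x (s.1 x), by
    intro x₀
    obtain ⟨X, hX⟩ := s.2 x₀
    refine ((τ.apply X).contMDiff x₀).congr_of_eventuallyEq ?_
    filter_upwards [hX] with x hx
    rw [hx]
    rfl⟩

variable [FiniteDimensional ℝ E]

/-- `τ` is weakly integrable: `E = im τ` is closed under the Courant bracket. -/
def IsWeaklyIntegrable : Prop :=
  ∀ (s t : τ.imageSections) (x : M), courantBracket (τ.ofImage s) (τ.ofImage t) x ∈ τ.image x

/-- The Courant-Nijenhuis torsion of `τ`. -/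
def courantNijenhuis (X Y : BigSections I M) (x : M) : BigTangentSpace I x :=
  courantBracket (τ.apply X) (τ.apply Y) x - τ.toFun x (courantBracket X (τ.apply Y) x)
    - τ.toFun x (courantBracket (τ.apply X) Y x) + τ.toFun x (τ.toFun x (courantBracket X Y x))

/-- `τ` is integrable: its Courant-Nijenhuis torsion vanishes. -/
def IsIntegrable : Prop := ∀ (X Y : BigSections I M) (x : M), τ.courantNijenhuis X Y x = 0

/-- The Courant bracket on `Γ E`. -/
def imageBracket (hτ : τ.IsWeaklyIntegrable) (s t : τ.imageSections) (x : M) : τ.Image x :=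
  ⟨courantBracket (τ.ofImage s) (τ.ofImage t) x, hτ s t x⟩

/-- The anchor of `E`, the restriction of the projection of the big tangent bundle on `TM`. -/
def imageAnchor (x : M) : τ.Image x →ₗ[ℝ] TangentSpace I x :=
  (LinearMap.fst ℝ (TangentSpace I x) (CotangentSpace I x)).comp (τ.incl x)

/-- The bracket `[s, t]_Ẽ = τ'⁻¹ [τ' s, τ' t]` on `Γ Ẽ`. -/
def quotBracket (hτ : τ.IsWeaklyIntegrable) (s t : τ.quotSections) (x : M) : τ.Quot x :=
  (τ.tauPrime x).symm (τ.imageBracket hτ (τ.tauPrimeSection s) (τ.tauPrimeSection t) x)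

/-- The anchor `pr_TM ∘ τ'` of `Ẽ`. -/
def quotAnchor (x : M) : τ.Quot x →ₗ[ℝ] TangentSpace I x :=
  (τ.imageAnchor x).comp (τ.tauPrime x).toLinearMap

/-- The bracket `[𝒳, 𝒴]_τ = [τ 𝒳, 𝒴] + [𝒳, τ 𝒴]` on `Γ 𝐓M`. -/
def tauBracket (X Y : BigSections I M) (x : M) : BigTangentSpace I x :=
  courantBracket (τ.apply X) Y x + courantBracket X (τ.apply Y) x

theorem exists_mkQuot_eq [T2Space M] [SigmaCompactSpace M] (s : τ.quotSections) :
    ∃ X : BigSections I M, τ.mkQuot X = s := by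
  obtain ⟨X, hX⟩ := exists_contMDiffSection_forall_mem_convex_of_local I (n := ⊤)
    (F_fiber := BigModel E)
    (fun x : M ↦ BigTangentSpace I x) (fun x ↦ {v | τ.proj x v = s.1 x})
    (by
      intro x v hv w hw a b _ _ hab
      change τ.proj x _ = _ at hv hw ⊢
      rw [map_add, map_smul, map_smul, hv, hw, ← add_smul, hab, one_smul])
    (by
      intro x₀
      obtain ⟨X, hX⟩ := s.2 x₀
      exact ⟨_, hX, X, X.contMDiff.contMDiffOn, fun y hy ↦ hy.symm⟩)
  exact ⟨X, Subtype.ext (funext hX)⟩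

/-- The induced `τ`-bracket on `Γ Ẽ`: the class of `[𝒳, 𝒴]_τ`, where `𝒳` and `𝒴` represent the two
sections. (For a weakly integrable `τ` it does not depend on the choice.) -/
def inducedBracket [T2Space M] [SigmaCompactSpace M] (s t : τ.quotSections) (x : M) : τ.Quot x :=
  τ.proj x
    (τ.tauBracket (τ.exists_mkQuot_eq s).choose (τ.exists_mkQuot_eq t).choose x)

end TwoNilpotentStructure

end TwoNilpotent

end

end BigTangent

/-!
`E = im τ` is `g`-isotropic with orthogonal `ker τ`, since `τ` is `g`-skew with `τ² = 0`. The
defects of the Courant bracket (in the Leibniz rule and in the Jacobi identity) are expressed by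
values and derivatives of `g`, so they vanish on `Γ E` as soon as `Γ E` is closed under the
bracket: then `E` is a Lie algebroid. Moreover `g([𝒳, 𝒴], 𝒵)` is invariant under cyclic
permutations of mutually orthogonal sections, and for `𝒳` in `ker τ` and `𝒴, 𝒵` in `E` this gives
`[ker τ, E] ⊆ ker τ`, which makes the induced `τ`-bracket well defined. Finally, under `τ'` the
induced bracket becomes `τ [𝒳, 𝒴]_τ`, while `[ , ]_Ẽ` becomes `[τ𝒳, τ𝒴]`; their difference is the
Courant-Nijenhuis torsion, and if it vanishes the Lie algebroid structure of `E` is carried over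
to `Ẽ` by `τ'`.
-/

namespace BigTangent

noncomputable section

section Analysis

open VectorField Set

variable {E : Type*} [NormedAddCommGroup E] [NormedSpace ℝ E]
  {H : Type*} [TopologicalSpace H] {I : ModelWithCorners ℝ E H}
  {M : Type*} [TopologicalSpace M] [ChartedSpace H M]
  {G : Type*} [NormedAddCommGroup G] [NormedSpace ℝ G]

variable (I) in
/-- The vector field `X` read in the extended chart at `x`. -/
def inChart (x : M) (X : Π y : M, TangentSpace I y) : E → E :=
  mpullbackWithin 𝓘(ℝ, E) I (extChartAt I x).symm X (range I)

theorem mvfderiv_apply_eq_fderivWithin_inChart [IsManifold I 1 M] {f : M → G} {x : M} {z : E}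
    (hz : z ∈ (extChartAt I x).target) (hf : MDiffAt f ((extChartAt I x).symm z))
    (X : Π y : M, TangentSpace I y) :
    mvfderiv I f ((extChartAt I x).symm z) (X ((extChartAt I x).symm z)) =
      fderivWithin ℝ (f ∘ (extChartAt I x).symm) (range I) z (inChart I x X z) := by
  have hcomp : mfderivWithin 𝓘(ℝ, E) 𝓘(ℝ, G) (f ∘ (extChartAt I x).symm) (range I) z =
      (mfderiv I 𝓘(ℝ, G) f ((extChartAt I x).symm z)) ∘L
        (mfderivWithin 𝓘(ℝ, E) I (extChartAt I x).symm (range I) z) :=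
    mfderiv_comp_mfderivWithin z hf (mdifferentiableWithinAt_extChartAt_symm hz)
      (I.uniqueMDiffOn _ (extChartAt_target_subset_range x hz))
  rw [mfderivWithin_eq_fderivWithin] at hcomp
  rw [hcomp, inChart, mpullbackWithin_apply]
  exact congrArg (mfderiv I 𝓘(ℝ, G) f ((extChartAt I x).symm z))
    ((isInvertible_mfderivWithin_extChartAt_symm hz).self_apply_inverse _).symm

theorem inChart_apply_self [IsManifold I 1 M] (x : M) (X : Π y : M, TangentSpace I y) :
    inChart I x X (extChartAt I x x) = X x :=
  (mfderivWithin_extChartAt_symm_inverse_apply (I := I) (x := x) _).trans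
    (congrArg (fun y ↦ (X y : E)) (extChartAt_to_inv x))

theorem differentiableWithinAt_inChart [IsManifold I 2 M] [CompleteSpace E] {x : M}
    {X : Π y : M, TangentSpace I y} (hX : MDiffAt (T% X) x) :
    DifferentiableWithinAt ℝ (inChart I x X) (range I) (extChartAt I x x) := by
  have : IsManifold I (minSmoothness ℝ 2) M := by simpa using ‹IsManifold I 2 M›
  have h := (hX.mdifferentiableWithinAt
    (s := univ)).differentiableWithinAt_mpullbackWithin_vectorField
  rwa [preimage_univ, univ_inter] at h

theorem inChart_mlieBracket [IsManifold I 1 M] (x : M) (X Y : Π y : M, TangentSpace I y) :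
    inChart I x (mlieBracket I X Y) (extChartAt I x x) =
      lieBracketWithin ℝ (inChart I x X) (inChart I x Y) (range I) (extChartAt I x x) := by
  rw [inChart_apply_self, mlieBracket, mlieBracketWithin_apply, preimage_univ, univ_inter,
    mfderiv_extChartAt_self]
  exact congrArg (fun L : E →L[ℝ] E ↦ L _) ContinuousLinearMap.inverse_id

theorem contMDiff_mvfderiv_apply {m n : ℕ∞ω} [IsManifold I 1 M] {f : M → G} (hf : CMDiff n f)
    {X : Π x : M, TangentSpace I x} (hX : CMDiff m (T% X)) (hmn : m + 1 ≤ n) :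
    CMDiff m (fun x ↦ mvfderiv I f x (X x)) :=
  (contMDiff_snd_tangentBundle_modelSpace G 𝓘(ℝ, G)).comp ((hf.contMDiff_tangentMap hmn).comp hX)

theorem mdifferentiableAt_mvfderiv_apply [IsManifold I 1 M] {f : M → G} (hf : CMDiff 2 f)
    {X : Π x : M, TangentSpace I x} {x : M} (hX : MDiffAt (T% X) x) :
    MDiffAt (fun y ↦ mvfderiv I f y (X y)) x :=
  ((contMDiff_snd_tangentBundle_modelSpace G 𝓘(ℝ, G)).mdifferentiableAt one_ne_zero).comp x
    (((hf.contMDiff_tangentMap (m := 1) (by norm_num)).mdifferentiableAt one_ne_zero).comp x hX)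

theorem mvfderiv_mlieBracket [IsManifold I 2 M] [CompleteSpace E] {X Y : Π x : M, TangentSpace I x}
    {f : M → G} {x : M} (hX : MDiffAt (T% X) x) (hY : MDiffAt (T% Y) x) (hf : CMDiff 2 f) :
    mvfderiv I f x (mlieBracket I X Y x) =
      mvfderiv I (fun y ↦ mvfderiv I f y (Y y)) x (X x) -
        mvfderiv I (fun y ↦ mvfderiv I f y (X y)) x (Y x) := by
  have : IsManifold I 1 M := .of_le (n := 2) (by norm_num)
  set φ := extChartAt I x
  have hφx : φ x ∈ φ.target := mem_extChartAt_target x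
  have hrange : φ x ∈ range I := extChartAt_target_subset_range x hφx
  have hfd : MDiff f := hf.mdifferentiable (by norm_num)
  have at_center {g : M → G} (hg : MDiffAt g x) (Z : Π y : M, TangentSpace I y) :
      mvfderiv I g x (Z x) =
        fderivWithin ℝ (g ∘ φ.symm) (range I) (φ x) (inChart I x Z (φ x)) := by
    rw [← mvfderiv_apply_eq_fderivWithin_inChart hφx (by rwa [extChartAt_to_inv]),
      extChartAt_to_inv]
  have near_center (Z : Π y : M, TangentSpace I y) :
      (fun y ↦ mvfderiv I f y (Z y)) ∘ φ.symm =ᶠ[𝓝[range I] φ x]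
        fun w ↦ fderivWithin ℝ (f ∘ φ.symm) (range I) w (inChart I x Z w) := by
    filter_upwards [extChartAt_target_mem_nhdsWithin x] with w hw
    exact mvfderiv_apply_eq_fderivWithin_inChart hw (hfd _) Z
  rw [at_center (hfd x), inChart_mlieBracket,
    at_center (mdifferentiableAt_mvfderiv_apply hf hX),
    at_center (mdifferentiableAt_mvfderiv_apply hf hY),
    (near_center X).fderivWithin_eq_of_mem hrange, (near_center Y).fderivWithin_eq_of_mem hrange]
  exact fderivWithin_apply_lieBracket (contMDiffAt_iff.1 (hf x)).2 (by simp) I.uniqueDiffOn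
    (I.range_subset_closure_interior hrange) hrange (differentiableWithinAt_inChart hY)
    (differentiableWithinAt_inChart hX)

end Analysis

section Extension

variable {E : Type*} [NormedAddCommGroup E] [NormedSpace ℝ E] [FiniteDimensional ℝ E]
  {H : Type*} [TopologicalSpace H] {I : ModelWithCorners ℝ E H}
  {M : Type*} [TopologicalSpace M] [ChartedSpace H M] [IsManifold I ∞ M]
  [T2Space M] [SigmaCompactSpace M]

section Sections

variable {F : Type*} [NormedAddCommGroup F] [NormedSpace ℝ F]
  {V : M → Type*} [∀ x, AddCommGroup (V x)] [∀ x, Module ℝ (V x)] [∀ x, TopologicalSpace (V x)]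
  [TopologicalSpace (Bundle.TotalSpace F V)] [FiberBundle F V] [VectorBundle ℝ F V]

theorem exists_contMDiffSection_eventuallyEq {x₀ : M} {U : Set M} (hU : U ∈ 𝓝 x₀)
    {s : Π x : M, V x} (hs : CMDiff[U] ∞ (T% s)) :
    ∃ Z : Cₛ^∞⟮I; F, V⟯, ∀ᶠ x in 𝓝 x₀, Z x = s x := by
  have : LocallyCompactSpace M := Manifold.locallyCompact_of_finiteDimensional I
  obtain ⟨C, ⟨hC, hC_closed⟩, hCU⟩ :=
    (closed_nhds_basis x₀).mem_iff.1 (interior_mem_nhds.2 hU)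
  obtain ⟨Z, hZ⟩ := exists_contMDiffSection_forall_mem_convex_of_local I (n := ⊤) (F_fiber := F) V
    (fun x ↦ {v | x ∈ C → v = s x})
    (fun x v hv w hw a b _ _ hab hx ↦ by rw [hv hx, hw hx, ← add_smul, hab, one_smul])
    (fun y ↦ by
      by_cases hy : y ∈ C
      · exact ⟨U, mem_interior_iff_mem_nhds.1 (hCU hy), s, hs, fun _ _ _ ↦ rfl⟩
      · exact ⟨Cᶜ, hC_closed.isOpen_compl.mem_nhds hy, 0,
          (Bundle.contMDiff_zeroSection ℝ V).contMDiffOn, fun z hz h ↦ absurd h hz⟩)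
  exact ⟨Z, Filter.mem_of_superset hC hZ⟩

theorem exists_contMDiffSection_apply_eq [ContMDiffVectorBundle ∞ F V I] {x₀ : M} (v : V x₀) :
    ∃ Z : Cₛ^∞⟮I; F, V⟯, Z x₀ = v := by
  obtain ⟨U, hU, hs⟩ := FiberBundle.exists_contMDiffOn_extend (I := I) (k := ∞) F v
  obtain ⟨Z, hZ⟩ := exists_contMDiffSection_eventuallyEq hU hs
  exact ⟨Z, by simpa using hZ.self_of_nhds⟩

end Sections

theorem exists_contMDiffMap_eventuallyEq {x₀ : M} {U : Set M} (hU : U ∈ 𝓝 x₀) {g : M → ℝ}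
    (hg : CMDiff[U] ∞ g) : ∃ f : C^∞⟮I, M; ℝ⟯, ∀ᶠ x in 𝓝 x₀, f x = g x := by
  obtain ⟨Z, hZ⟩ := exists_contMDiffSection_eventuallyEq (V := fun _ : M ↦ ℝ) hU
    fun x hx ↦ Bundle.contMDiffWithinAt_section.2 (hg x hx)
  exact ⟨⟨Z, fun x ↦ (Bundle.contMDiffAt_section _).1 (Z.contMDiff x)⟩, hZ⟩

end Extension

section Cotangent

variable {E : Type*} [NormedAddCommGroup E] [NormedSpace ℝ E] [FiniteDimensional ℝ E]
  {H : Type*} [TopologicalSpace H] {I : ModelWithCorners ℝ E H}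
  {M : Type*} [TopologicalSpace M] [ChartedSpace H M]

theorem contMDiffAt_clm_of_apply {n : ℕ∞ω} {G : Type*} [NormedAddCommGroup G] [NormedSpace ℝ G]
    {A : M → E →L[ℝ] G} {x₀ : M} (hA : ∀ v, CMDiffAt n (fun x ↦ A x v) x₀) : CMDiffAt n A x₀ := by
  let b := Module.finBasis ℝ E
  let coord i := LinearMap.toContinuousLinearMap (b.coord i)
  have hsum : A = fun x ↦ ∑ i, (coord i).smulRight (A x (b i)) := by
    ext x v
    conv_lhs => rw [← b.sum_repr v, map_sum]
    simp [coord]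
  rw [hsum]
  exact contMDiffAt_finsetSum fun i _ ↦
    (ContinuousLinearMap.smulRightL ℝ E G (coord i)).contMDiff.contMDiffAt.comp x₀ (hA (b i))

variable [IsManifold I ∞ M] [T2Space M] [SigmaCompactSpace M]

theorem contMDiff_cotangent_of_apply {θ : Π x : M, CotangentSpace I x}
    (hθ : ∀ Z : VectorFields I M, CMDiff ∞ (fun x ↦ θ x (Z x))) :
    ContMDiff I (I.prod 𝓘(ℝ, E →L[ℝ] ℝ)) ∞ (fun x ↦
      Bundle.TotalSpace.mk' (E →L[ℝ] ℝ) (E := fun x : M ↦ CotangentSpace I x) x (θ x)) := by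
  intro x₀
  refine contMDiffAt_hom_bundle _ |>.2 ⟨contMDiffAt_id, contMDiffAt_clm_of_apply fun v ↦ ?_⟩
  set e := trivializationAt E (TangentSpace I) x₀
  have h_symm : CMDiff[e.baseSet] ∞ (T% fun x ↦ e.symmL ℝ x v) :=
    ContMDiffOn.clm_bundle_apply (F₁ := E) (E₁ := fun _ : M ↦ E) e.contMDiffOn_symmL
      fun x _ ↦ Bundle.contMDiffWithinAt_section.2 contMDiffWithinAt_const
  obtain ⟨Z, hZ⟩ := exists_contMDiffSection_eventuallyEq
    (e.open_baseSet.mem_nhds (FiberBundle.mem_baseSet_trivializationAt' x₀)) h_symm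
  refine (hθ Z x₀).congr_of_eventuallyEq ?_
  filter_upwards [hZ] with x hx
  simp [hx, ContinuousLinearMap.inCoordinates, e]

end Cotangent

section LocalFrames

variable {E : Type*} [NormedAddCommGroup E] [NormedSpace ℝ E]
  {H : Type*} [TopologicalSpace H] {I : ModelWithCorners ℝ E H}
  {M : Type*} [TopologicalSpace M] [ChartedSpace H M]

/-- With `P` a left inverse of `a x₀`, the map `P ∘ a x` is invertible near `x₀`, and
`(P ∘ a x)⁻¹ ∘ P` is a left inverse of `a x`. -/
theorem exists_contMDiffOn_leftInverse {n : ℕ∞ω} {F₁ F₂ : Type*} [NormedAddCommGroup F₁]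
    [NormedSpace ℝ F₁] [CompleteSpace F₁] [NormedAddCommGroup F₂] [NormedSpace ℝ F₂]
    {a : M → F₁ →L[ℝ] F₂} {U : Set M} {x₀ : M} (hU : U ∈ 𝓝 x₀) (ha : CMDiff[U] n a)
    {P : F₂ →L[ℝ] F₁} (hP : P ∘L a x₀ = .id ℝ F₁) :
    ∃ U' ∈ 𝓝 x₀, ∃ κ : M → F₂ →L[ℝ] F₁, CMDiff[U'] n κ ∧ ∀ x ∈ U', κ x ∘L a x = .id ℝ F₁ := by
  have hG : CMDiff[U] n (fun x ↦ P ∘L a x) := contMDiffOn_const.clm_comp ha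
  have hU' : U ∩ (fun x ↦ P ∘L a x) ⁻¹' {L | IsUnit L} ∈ 𝓝 x₀ := by
    have h_cont := (hG x₀ (mem_of_mem_nhds hU)).continuousWithinAt.continuousAt hU
    exact Filter.inter_mem hU (h_cont.preimage_mem_nhds
      (Units.isOpen.mem_nhds (hP ▸ isUnit_one (M := F₁ →L[ℝ] F₁))))
  refine ⟨_, hU', fun x ↦ Ring.inverse (P ∘L a x) ∘L P, ?_, fun x hx ↦
    (ContinuousLinearMap.comp_assoc _ _ _).trans (Ring.inverse_mul_cancel _ hx.2)⟩
  refine ContMDiffOn.clm_comp (fun x hx ↦ ?_) contMDiffOn_const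
  have h_inverse : CMDiffAt n (Ring.inverse : (F₁ →L[ℝ] F₁) → F₁ →L[ℝ] F₁) (P ∘L a x) :=
    (contDiffAt_ringInverse ℝ hx.2.unit).contMDiffAt
  exact (h_inverse.comp_contMDiffWithinAt x (hG x hx.1)).mono Set.inter_subset_left

variable {F : Type*} [NormedAddCommGroup F] [NormedSpace ℝ F] [FiniteDimensional ℝ F]
  {V : M → Type*} [∀ x, AddCommGroup (V x)] [∀ x, Module ℝ (V x)] [∀ x, TopologicalSpace (V x)]
  [TopologicalSpace (Bundle.TotalSpace F V)] [FiberBundle F V] [VectorBundle ℝ F V]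
  [ContMDiffVectorBundle ∞ F V I] {ι : Type*}

theorem exists_contMDiffOn_coefficients [Fintype ι] {s : ι → Cₛ^∞⟮I; F, V⟯} {x₀ : M}
    (hs : LinearIndependent ℝ fun i ↦ s i x₀) :
    ∃ U ∈ 𝓝 x₀, ∃ κ : Π x, V x →ₗ[ℝ] ι → ℝ, (∀ x ∈ U, ∀ c, κ x (∑ i, c i • s i x) = c) ∧
      ∀ (A : Cₛ^∞⟮I; F, V⟯) (i : ι), CMDiff[U] ∞ (fun x ↦ κ x (A x) i) := by
  let e := trivializationAt F V x₀
  have hx₀ : x₀ ∈ e.baseSet := FiberBundle.mem_baseSet_trivializationAt' x₀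
  have he : e.baseSet ∈ 𝓝 x₀ := e.open_baseSet.mem_nhds hx₀
  have h_triv (A : Cₛ^∞⟮I; F, V⟯) : CMDiff[e.baseSet] ∞ (fun x ↦ e.linearMapAt ℝ x (A x)) :=
    (e.contMDiffOn_section_baseSet_iff.1 A.contMDiff.contMDiffOn).congr fun x hx ↦ by
      rw [e.coe_linearMapAt_of_mem hx]
  let a (x : M) : (ι → ℝ) →L[ℝ] F :=
    ∑ i, (ContinuousLinearMap.proj i).smulRight (e.linearMapAt ℝ x (s i x))
  have ha_apply (x : M) (c : ι → ℝ) : a x c = e.linearMapAt ℝ x (∑ i, c i • s i x) := by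
    simp [a]
  have ha : CMDiff[e.baseSet] ∞ a := contMDiffOn_finsetSum fun i _ ↦
    (ContinuousLinearMap.smulRightL ℝ (ι → ℝ) F (.proj i)).contMDiff.comp_contMDiffOn (h_triv (s i))
  have ha_ker : LinearMap.ker (a x₀).toLinearMap = ⊥ := by
    rw [LinearMap.ker_eq_bot]
    intro c c' h
    simp only [ContinuousLinearMap.coe_coe, ha_apply, e.coe_linearMapAt_of_mem hx₀] at h
    exact linearIndependent_iff_injective_fintypeLinearCombination.1 hs
      ((e.linearEquivAt ℝ x₀ hx₀).injective h)
  obtain ⟨P, hP⟩ := LinearMap.exists_leftInverse_of_injective _ ha_ker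
  obtain ⟨U, hU, κ, hκ, hκa⟩ := exists_contMDiffOn_leftInverse he ha
    (P := LinearMap.toContinuousLinearMap P) (ContinuousLinearMap.coe_inj.1 hP)
  refine ⟨U ∩ e.baseSet, Filter.inter_mem hU he, fun x ↦ (κ x).toLinearMap ∘ₗ e.linearMapAt ℝ x,
    fun x hx c ↦ ?_, fun A i ↦ ?_⟩
  · simpa [ha_apply] using congrArg (fun L : (ι → ℝ) →L[ℝ] ι → ℝ ↦ L c) (hκa x hx.1)
  · exact (ContinuousLinearMap.proj (R := ℝ) (φ := fun _ : ι ↦ ℝ) i).contMDiff.comp_contMDiffOn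
      ((hκ.mono Set.inter_subset_left).clm_apply ((h_triv A).mono Set.inter_subset_right))

theorem eventually_linearIndependent [Finite ι] {s : ι → Cₛ^∞⟮I; F, V⟯} {x₀ : M}
    (hs : LinearIndependent ℝ fun i ↦ s i x₀) :
    ∀ᶠ x in 𝓝 x₀, LinearIndependent ℝ fun i ↦ s i x := by
  cases nonempty_fintype ι
  obtain ⟨U, hU, κ, hκ, -⟩ := exists_contMDiffOn_coefficients hs
  filter_upwards [hU] with x hx
  exact linearIndependent_iff_injective_fintypeLinearCombination.2
    (Function.LeftInverse.injective (g := κ x) (hκ x hx))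

theorem exists_contMDiffMap_coefficients [FiniteDimensional ℝ E] [IsManifold I ∞ M] [T2Space M]
    [SigmaCompactSpace M] [Fintype ι] {s : ι → Cₛ^∞⟮I; F, V⟯} {x₀ : M}
    (hs : LinearIndependent ℝ fun i ↦ s i x₀) {A : Cₛ^∞⟮I; F, V⟯}
    (hA : ∀ᶠ x in 𝓝 x₀, A x ∈ Submodule.span ℝ (Set.range fun i ↦ s i x)) :
    ∃ f : ι → C^∞⟮I, M; ℝ⟯, ∀ᶠ x in 𝓝 x₀, A x = ∑ i, f i x • s i x := by
  obtain ⟨U, hU, κ, hκ, hκ_smooth⟩ := exists_contMDiffOn_coefficients hs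
  choose f hf using fun i ↦ exists_contMDiffMap_eventuallyEq hU (hκ_smooth A i)
  refine ⟨f, ?_⟩
  filter_upwards [hU, hA, Filter.eventually_all.2 hf] with x hx hAx hfx
  obtain ⟨c, hc⟩ := (Submodule.mem_span_range_iff_exists_fun ℝ).1 hAx
  simp only [hfx, ← hc, hκ x hx c]

end LocalFrames

section FunctionModule

variable {E : Type*} [NormedAddCommGroup E] [NormedSpace ℝ E]
  {H : Type*} [TopologicalSpace H] {I : ModelWithCorners ℝ E H}
  {M : Type*} [TopologicalSpace M] [ChartedSpace H M]
  {F : Type*} [NormedAddCommGroup F] [NormedSpace ℝ F]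
  {V : M → Type*} [∀ x, AddCommGroup (V x)] [∀ x, Module ℝ (V x)] [∀ x, TopologicalSpace (V x)]
  [TopologicalSpace (Bundle.TotalSpace F V)] [FiberBundle F V] [VectorBundle ℝ F V] {n : ℕ∞ω}

instance : SMul C^n⟮I, M; ℝ⟯ Cₛ^n⟮I; F, V⟯ where
  smul f s := ⟨fun x ↦ f x • s x, f.contMDiff.smul_section s.contMDiff⟩

instance : Module C^n⟮I, M; ℝ⟯ Cₛ^n⟮I; F, V⟯ where
  one_smul s := by ext x; exact one_smul ℝ (s x)
  mul_smul f g s := by ext x; exact mul_smul (f x) (g x) (s x)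
  smul_zero f := by ext x; exact smul_zero (f x)
  smul_add f s t := by ext x; exact smul_add (f x) (s x) (t x)
  add_smul f g s := by ext x; exact add_smul (f x) (g x) (s x)
  zero_smul s := by ext x; exact zero_smul ℝ (s x)

instance : IsScalarTower ℝ C^n⟮I, M; ℝ⟯ Cₛ^n⟮I; F, V⟯ where
  smul_assoc c f s := by ext x; exact smul_assoc c (f x) (s x)

theorem mdifferentiableAt_coe (f : C^∞⟮I, M; ℝ⟯) (x : M) : MDiffAt f x :=
  (f.contMDiff x).mdifferentiableAt (by simp)

end FunctionModule

section Calculus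

variable {E : Type*} [NormedAddCommGroup E] [NormedSpace ℝ E]
  {H : Type*} [TopologicalSpace H] {I : ModelWithCorners ℝ E H}
  {M : Type*} [TopologicalSpace M] [ChartedSpace H M] [IsManifold I ∞ M]

/-- The pairing `μ(Z)` of a `1`-form and a vector field, bilinear over the smooth functions. -/
def pairing : OneForms I M →ₗ[C^∞⟮I, M; ℝ⟯] VectorFields I M →ₗ[C^∞⟮I, M; ℝ⟯] C^∞⟮I, M; ℝ⟯ :=
  LinearMap.mk₂ _
    (fun μ Z ↦ ⟨fun x ↦ μ x (Z x), fun x ↦ (Bundle.contMDiffAt_section _).1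
      ((μ.contMDiff x).clm_bundle_apply (F₂ := ℝ) (E₂ := fun _ : M ↦ ℝ) (Z.contMDiff x))⟩)
    (fun _ _ _ ↦ rfl) (fun _ _ _ ↦ rfl)
    (fun μ Z Z' ↦ by ext x; exact map_add (μ x) (Z x) (Z' x))
    (fun f μ Z ↦ by ext x; exact map_smul (μ x) (f x) (Z x))

section FiniteDimensional

variable [FiniteDimensional ℝ E]

instance : Bracket (VectorFields I M) (VectorFields I M) where
  bracket X Y := ⟨VectorField.mlieBracket I X Y, fun x ↦ by
    have : CompleteSpace E := FiniteDimensional.complete ℝ E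
    have : IsManifold I (minSmoothness ℝ 2) M :=
      .of_le (n := ∞) (by simpa using ENat.LEInfty.out)
    have : IsManifold I (((⊤ : ℕ∞) : ℕ∞ω) + 1) M := inferInstanceAs (IsManifold I ∞ M)
    exact ContMDiffAt.mlieBracket_vectorField (n := ⊤) (m := ⊤) (X.contMDiff x)
      (Y.contMDiff x) (by simp)⟩

instance : LieRing (VectorFields I M) where
  add_lie X Y Z := by
    have : CompleteSpace E := FiniteDimensional.complete ℝ E
    ext x
    exact VectorField.mlieBracket_add_left X.mdifferentiableAt Y.mdifferentiableAt
  lie_add X Y Z := by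
    have : CompleteSpace E := FiniteDimensional.complete ℝ E
    ext x
    exact VectorField.mlieBracket_add_right Y.mdifferentiableAt Z.mdifferentiableAt
  lie_self X := by
    ext x
    exact congrFun VectorField.mlieBracket_self x
  leibniz_lie X Y Z := by
    have : CompleteSpace E := FiniteDimensional.complete ℝ E
    have : IsManifold I (minSmoothness ℝ 3) M := .of_le (n := ∞) (by simpa using ENat.LEInfty.out)
    have h : minSmoothness ℝ 2 ≤ ∞ := by simpa using ENat.LEInfty.out
    ext x
    exact VectorField.leibniz_identity_mlieBracket_apply ((X.contMDiff x).of_le h)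
      ((Y.contMDiff x).of_le h) ((Z.contMDiff x).of_le h)

instance : LieAlgebra ℝ (VectorFields I M) where
  lie_smul c X Y := by
    have : CompleteSpace E := FiniteDimensional.complete ℝ E
    ext x
    exact VectorField.mlieBracket_const_smul_right Y.mdifferentiableAt

end FiniteDimensional

/-- The bracket `⁅X, f⁆` is the derivative `X f`. -/
instance : Bracket (VectorFields I M) C^∞⟮I, M; ℝ⟯ where
  bracket X f := ⟨fun x ↦ mvfderiv I f x (X x),
    contMDiff_mvfderiv_apply f.contMDiff X.contMDiff (by simp)⟩

theorem VectorFields.lie_coe_apply (X : VectorFields I M) (f : C^∞⟮I, M; ℝ⟯) (x : M) :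
    ⁅X, f⁆ x = mvfderiv I f x (X x) := rfl

theorem VectorFields.lie_mul (X : VectorFields I M) (f g : C^∞⟮I, M; ℝ⟯) :
    ⁅X, f * g⁆ = f * ⁅X, g⁆ + g * ⁅X, f⁆ := by
  ext x
  simp [lie_coe_apply, mvfderiv_mul (mdifferentiableAt_coe f x) (mdifferentiableAt_coe g x)]

theorem VectorFields.smul_lie_coe (X : VectorFields I M) (f g : C^∞⟮I, M; ℝ⟯) :
    ⁅f • X, g⁆ = f * ⁅X, g⁆ := by
  ext x
  exact map_smul (mvfderiv I g x) (f x) (X x)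

variable [FiniteDimensional ℝ E]

instance : LieRingModule (VectorFields I M) C^∞⟮I, M; ℝ⟯ where
  add_lie X Y f := by
    ext x
    exact map_add (mvfderiv I f x) (X x) (Y x)
  lie_add X f g := by
    ext x
    simp [VectorFields.lie_coe_apply,
      mvfderiv_add (mdifferentiableAt_coe f x) (mdifferentiableAt_coe g x)]
  leibniz_lie X Y f := by
    have : CompleteSpace E := FiniteDimensional.complete ℝ E
    have : IsManifold I 2 M := .of_le (n := ∞) ENat.LEInfty.out
    rw [← sub_eq_iff_eq_add, eq_comm]
    ext x
    exact mvfderiv_mlieBracket X.mdifferentiableAt Y.mdifferentiableAt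
      (f.contMDiff.of_le ENat.LEInfty.out)

instance : LieModule ℝ (VectorFields I M) C^∞⟮I, M; ℝ⟯ where
  smul_lie c X f := by
    ext x
    exact map_smul (mvfderiv I f x) c (X x)
  lie_smul c X f := by
    have h_const : ⁅X, algebraMap ℝ C^∞⟮I, M; ℝ⟯ c⁆ = 0 := by
      ext x
      exact congrArg (fun L ↦ L (X x)) (mvfderiv_const (I := I) c)
    rw [Algebra.smul_def, VectorFields.lie_mul, h_const, mul_zero, add_zero, Algebra.smul_def]

theorem VectorFields.lie_smul_coe (X Y : VectorFields I M) (f : C^∞⟮I, M; ℝ⟯) :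
    ⁅X, f • Y⁆ = f • ⁅X, Y⁆ + ⁅X, f⁆ • Y := by
  have : CompleteSpace E := FiniteDimensional.complete ℝ E
  ext x
  exact (VectorField.mlieBracket_smul_right (V := X) (mdifferentiableAt_coe f x)
    (Y.mdifferentiableAt (x := x))).trans (add_comm _ _)

variable [T2Space M] [SigmaCompactSpace M]

theorem OneForms.ext_pairing {μ ν : OneForms I M} (h : ∀ Z, pairing μ Z = pairing ν Z) :
    μ = ν := by
  ext x v
  obtain ⟨Z, rfl⟩ := exists_contMDiffSection_apply_eq (I := I) (F := E) (V := TangentSpace I) v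
  exact congrArg (fun f : C^∞⟮I, M; ℝ⟯ ↦ f x) (h Z)

/-- The Lie derivative `L_X μ` as a smooth `1`-form. -/
def OneForms.lieDeriv (X : VectorFields I M) (μ : OneForms I M) : OneForms I M where
  toFun := lieDerivative X μ
  contMDiff_toFun := contMDiff_cotangent_of_apply fun Z ↦
    (⁅X, pairing μ Z⁆ - pairing μ ⁅X, Z⁆).contMDiff.congr (lieDerivative_apply X μ · Z)

theorem OneForms.pairing_lieDeriv (X Z : VectorFields I M) (μ : OneForms I M) :
    pairing (lieDeriv X μ) Z = ⁅X, pairing μ Z⁆ - pairing μ ⁅X, Z⁆ := by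
  ext x
  exact lieDerivative_apply X μ x Z

/-- The differential `df` as a smooth `1`-form. -/
def OneForms.d (f : C^∞⟮I, M; ℝ⟯) : OneForms I M where
  toFun := mvfderiv I f
  contMDiff_toFun := contMDiff_cotangent_of_apply fun Z ↦ ⁅Z, f⁆.contMDiff

theorem OneForms.pairing_d (f : C^∞⟮I, M; ℝ⟯) (Z : VectorFields I M) :
    pairing (d f) Z = ⁅Z, f⁆ := rfl

end Calculus

section CourantCalculus

variable {E : Type*} [NormedAddCommGroup E] [NormedSpace ℝ E]
  {H : Type*} [TopologicalSpace H] {I : ModelWithCorners ℝ E H}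
  {M : Type*} [TopologicalSpace M] [ChartedSpace H M] [IsManifold I ∞ M]

namespace BigSections

/-- The section `(X, α)` of the big tangent bundle. -/
def mk (X : VectorFields I M) (α : OneForms I M) : BigSections I M where
  toFun x := (X x, α x)
  contMDiff_toFun x := by
    have hX := X.contMDiff x
    have hα := α.contMDiff x
    rw [Bundle.contMDiffAt_section] at hX hα ⊢
    exact hX.prodMk_space hα

/-- The neutral metric `g(A, B)` as a smooth function. -/
def metric (A B : BigSections I M) : C^∞⟮I, M; ℝ⟯ := pairing A.form B.vec + pairing B.form A.vec

theorem metric_apply (A B : BigSections I M) (x : M) :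
    metric A B x = neutralMetric I x (A x) (B x) := rfl

theorem metric_comm (A B : BigSections I M) : metric A B = metric B A := add_comm _ _

theorem metric_zero (A : BigSections I M) : metric A 0 = 0 := by
  ext x
  exact map_zero (neutralMetric I x (A x))

theorem metric_smul (A B : BigSections I M) (f : C^∞⟮I, M; ℝ⟯) :
    metric A (f • B) = f * metric A B := by
  ext x
  exact map_smul (neutralMetric I x (A x)) (f x) (B x)

theorem pairing_form_of_metric_eq_zero {A B : BigSections I M} (h : metric A B = 0) :
    pairing B.form A.vec = -pairing A.form B.vec :=
  eq_neg_of_add_eq_zero_right h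

variable {A B : BigSections I M}

@[simp] theorem form_zero : (0 : BigSections I M).form = 0 := rfl
@[simp] theorem vec_add : (A + B).vec = A.vec + B.vec := rfl
@[simp] theorem form_add : (A + B).form = A.form + B.form := rfl
@[simp] theorem vec_neg : (-A).vec = -A.vec := rfl
@[simp] theorem form_neg : (-A).form = -A.form := rfl
@[simp] theorem vec_smul (c : ℝ) : (c • A).vec = c • A.vec := rfl
@[simp] theorem form_smul (c : ℝ) : (c • A).form = c • A.form := rfl
@[simp] theorem vec_smul_coe (f : C^∞⟮I, M; ℝ⟯) : (f • A).vec = f • A.vec := rfl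
@[simp] theorem form_smul_coe (f : C^∞⟮I, M; ℝ⟯) : (f • A).form = f • A.form := rfl

variable [FiniteDimensional ℝ E] [T2Space M] [SigmaCompactSpace M]

theorem ext_pairing (hv : A.vec = B.vec) (hf : ∀ Z, pairing A.form Z = pairing B.form Z) :
    A = B := by
  have h_form := OneForms.ext_pairing hf
  ext x : 1
  exact Prod.ext (congrArg (fun X : VectorFields I M ↦ X x) hv)
    (congrArg (fun μ : OneForms I M ↦ μ x) h_form)

/-- The Courant bracket as a smooth section. -/
def courant (A B : BigSections I M) : BigSections I M :=
  mk ⁅A.vec, B.vec⁆ (OneForms.lieDeriv A.vec B.form - OneForms.lieDeriv B.vec A.form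
    + (1 / 2 : ℝ) • OneForms.d (pairing A.form B.vec - pairing B.form A.vec))

@[simp] theorem vec_courant : (courant A B).vec = ⁅A.vec, B.vec⁆ := rfl

theorem pairing_form_courant (Z : VectorFields I M) :
    pairing (courant A B).form Z =
      ⁅A.vec, pairing B.form Z⁆ - pairing B.form ⁅A.vec, Z⁆
        - (⁅B.vec, pairing A.form Z⁆ - pairing A.form ⁅B.vec, Z⁆)
        + (1 / 2 : ℝ) • ⁅Z, pairing A.form B.vec - pairing B.form A.vec⁆ := by
  rw [← OneForms.pairing_lieDeriv, ← OneForms.pairing_lieDeriv, ← OneForms.pairing_d]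
  rfl

theorem pairing_form_courant_of_metric_eq_zero (h : metric A B = 0) (Z : VectorFields I M) :
    pairing (courant A B).form Z =
      ⁅A.vec, pairing B.form Z⁆ - pairing B.form ⁅A.vec, Z⁆
        - ⁅B.vec, pairing A.form Z⁆ + pairing A.form ⁅B.vec, Z⁆ + ⁅Z, pairing A.form B.vec⁆ := by
  rw [pairing_form_courant, pairing_form_of_metric_eq_zero h]
  simp only [lie_sub, lie_neg]
  module

variable (A B)

theorem courant_skew : courant A B = -courant B A := by
  refine ext_pairing (by simp) fun Z ↦ ?_
  simp only [form_neg, map_neg, LinearMap.neg_apply, pairing_form_courant, lie_sub]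
  module

theorem courant_add (C : BigSections I M) : courant A (B + C) = courant A B + courant A C := by
  refine ext_pairing (by simp) fun Z ↦ ?_
  simp only [pairing_form_courant, vec_add, form_add, map_add, LinearMap.add_apply, lie_add,
    add_lie, lie_sub]
  module

theorem courant_smul (c : ℝ) : courant A (c • B) = c • courant A B := by
  refine ext_pairing (by simp) fun Z ↦ ?_
  simp only [pairing_form_courant, vec_smul, form_smul, LinearMap.map_smul_of_tower,
    LinearMap.smul_apply, lie_smul, smul_lie, lie_sub]
  module

theorem courant_sub (C : BigSections I M) : courant A (B - C) = courant A B - courant A C := by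
  rw [eq_sub_iff_add_eq, ← courant_add, sub_add_cancel]

theorem sub_courant (C : BigSections I M) : courant (A - B) C = courant A C - courant B C := by
  rw [courant_skew, courant_sub, courant_skew C A, courant_skew C B]
  abel

variable {A B}

theorem courant_smul_coe (h : metric A B = 0) (f : C^∞⟮I, M; ℝ⟯) :
    courant A (f • B) = f • courant A B + ⁅A.vec, f⁆ • B := by
  have hf : metric A (f • B) = 0 := by rw [metric_smul, h, mul_zero]
  refine ext_pairing (VectorFields.lie_smul_coe A.vec B.vec f) fun Z ↦ ?_
  simp only [pairing_form_courant_of_metric_eq_zero h, pairing_form_courant_of_metric_eq_zero hf,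
    form_add, form_smul_coe, vec_smul_coe, map_add, map_smul, LinearMap.add_apply,
    LinearMap.smul_apply, smul_eq_mul, VectorFields.lie_mul, VectorFields.smul_lie_coe]
  rw [← lie_skew (f • B.vec) Z, VectorFields.lie_smul_coe, ← lie_skew B.vec Z]
  simp only [map_neg, map_add, map_smul, smul_eq_mul]
  ring

theorem metric_courant_cyclic {C : BigSections I M} (hAB : metric A B = 0)
    (hBC : metric B C = 0) (hCA : metric C A = 0) :
    metric (courant A B) C = metric (courant B C) A := by
  rw [metric, metric, pairing_form_courant_of_metric_eq_zero hAB,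
    pairing_form_courant_of_metric_eq_zero hBC, vec_courant, vec_courant,
    ← lie_skew A.vec C.vec, ← lie_skew B.vec A.vec, pairing_form_of_metric_eq_zero hAB,
    pairing_form_of_metric_eq_zero hCA]
  simp only [map_neg, lie_neg]
  ring

/-- Paired with a vector field `W`, the Jacobiator is the derivative along `W` of `g(A, [B, C])`. -/
theorem courant_jacobi {C : BigSections I M} (hAB : metric A B = 0)
    (hBC : metric B C = 0) (hCA : metric C A = 0) (hA : metric A (courant B C) = 0)
    (hB : metric B (courant C A) = 0) (hC : metric C (courant A B) = 0) :
    courant A (courant B C) + courant B (courant C A) + courant C (courant A B) = 0 := by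
  refine ext_pairing (lie_jacobi A.vec B.vec C.vec) fun W ↦ ?_
  have h_deriv : ⁅W, metric A (courant B C)⁆ = 0 := by rw [hA, lie_zero]
  rw [metric, pairing_form_courant_of_metric_eq_zero hBC, vec_courant, ← lie_skew B.vec A.vec,
    pairing_form_of_metric_eq_zero hAB] at h_deriv
  simp only [lie_add, lie_sub, lie_neg, map_neg] at h_deriv
  simp only [form_add, form_zero, map_add, map_zero, map_sub, LinearMap.add_apply,
    LinearMap.zero_apply,
    pairing_form_courant_of_metric_eq_zero hA, pairing_form_courant_of_metric_eq_zero hB,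
    pairing_form_courant_of_metric_eq_zero hC, pairing_form_courant_of_metric_eq_zero hAB,
    pairing_form_courant_of_metric_eq_zero hBC, pairing_form_courant_of_metric_eq_zero hCA,
    vec_courant, lie_add, lie_sub, lie_lie]
  linear_combination h_deriv

end BigSections

end CourantCalculus

section ImageBundle

variable {E : Type*} [NormedAddCommGroup E] [NormedSpace ℝ E]
  {H : Type*} [TopologicalSpace H] {I : ModelWithCorners ℝ E H}
  {M : Type*} [TopologicalSpace M] [ChartedSpace H M]

instance [FiniteDimensional ℝ E] (x : M) : FiniteDimensional ℝ (BigTangentSpace I x) :=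
  inferInstanceAs (FiniteDimensional ℝ (E × (E →L[ℝ] ℝ)))

theorem eq_zero_of_forall_neutralMetric_eq_zero {x : M} {v : BigTangentSpace I x}
    (hv : ∀ w, neutralMetric I x w v = 0) : v = 0 := by
  have h_fst : v.1 = 0 := SeparatingDual.eq_zero_of_forall_dual_eq_zero (R := ℝ) (V := E)
    fun f ↦ by
      have h : f v.1 + v.2 0 = 0 := hv (0, f)
      rwa [map_zero, add_zero] at h
  have h_snd : v.2 = 0 := ContinuousLinearMap.ext fun z ↦ by simpa [neutralMetric] using hv (z, 0)
  exact Prod.ext h_fst h_snd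

variable [IsManifold I ∞ M]

theorem BigSections.eq_zero_of_forall_metric_eq_zero [FiniteDimensional ℝ E] [T2Space M]
    [SigmaCompactSpace M] {A : BigSections I M} (hA : ∀ W, metric W A = 0) : A = 0 := by
  ext x : 1
  refine eq_zero_of_forall_neutralMetric_eq_zero fun w ↦ ?_
  obtain ⟨W, rfl⟩ := exists_contMDiffSection_apply_eq (I := I) (F := BigModel E)
    (V := fun x : M ↦ BigTangentSpace I x) w
  rw [← metric_apply, hA]
  rfl

namespace TwoNilpotentStructure

variable (τ : TwoNilpotentStructure I M)

theorem apply_apply (X : BigSections I M) (x : M) : τ.apply X x = τ.toFun x (X x) := rfl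

theorem apply_sub (X Y : BigSections I M) : τ.apply (X - Y) = τ.apply X - τ.apply Y := by
  ext x : 1
  exact map_sub (τ.toFun x) _ _

theorem apply_mem (X : BigSections I M) (x : M) : τ.apply X x ∈ τ.image x := ⟨X x, rfl⟩

theorem ofImage_mem (s : τ.imageSections) (x : M) : τ.ofImage s x ∈ τ.image x :=
  Subtype.property (p := (· ∈ τ.image x)) (s.1 x)

theorem incl_injective (x : M) : Function.Injective (τ.incl x) := Subtype.val_injective

theorem range_incl (x : M) : LinearMap.range (τ.incl x) = τ.image x :=
  Submodule.range_subtype _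

theorem ofImage_injective : Function.Injective τ.ofImage := fun _ _ h ↦
  Subtype.ext (funext fun x ↦ τ.incl_injective x (congrArg (fun A : BigSections I M ↦ A x) h))

/-- The section of `E` given by a section of the big tangent bundle with values in `E`. -/
def toImage (A : BigSections I M) (hA : ∀ x, A x ∈ τ.image x) : τ.imageSections :=
  ⟨fun x ↦ (⟨A x, hA x⟩ : τ.image x), A.contMDiff⟩

variable [FiniteDimensional ℝ E] [T2Space M] [SigmaCompactSpace M]

theorem exists_image_frame {r : ℕ} (hr : ∀ x, Module.finrank ℝ (τ.image x) = r) (x₀ : M) :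
    ∃ X : Fin r → BigSections I M, ∀ᶠ x in 𝓝 x₀, LinearIndependent ℝ (fun i ↦ τ.apply (X i) x) ∧
      Submodule.span ℝ (Set.range fun i ↦ τ.apply (X i) x) = τ.image x := by
  have : Module.Free ℝ (τ.image x₀) := inferInstanceAs (Module.Free ℝ (τ.Image x₀))
  let b : Module.Basis (Fin r) ℝ (τ.image x₀) := Module.finBasisOfFinrankEq ℝ _ (hr x₀)
  have h_lift (i) : ∃ X : BigSections I M, τ.apply X x₀ = b i := by
    obtain ⟨v, hv⟩ := (b i).2
    obtain ⟨X, rfl⟩ := exists_contMDiffSection_apply_eq (I := I) (F := BigModel E)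
      (V := fun x : M ↦ BigTangentSpace I x) v
    exact ⟨X, hv⟩
  choose X hX using h_lift
  have h_indep : LinearIndependent ℝ fun i ↦ τ.apply (X i) x₀ := by
    rw [funext hX]
    exact b.linearIndependent.map_injOn (τ.image x₀).subtype Subtype.val_injective.injOn
  refine ⟨X, (eventually_linearIndependent h_indep).mono fun x hx ↦ ⟨hx, ?_⟩⟩
  refine Submodule.eq_of_le_of_finrank_eq ?_ ?_
  · exact Submodule.span_le.2 (Set.range_subset_iff.2 fun i ↦ τ.apply_mem (X i) x)
  · rw [finrank_span_eq_card hx, hr, Fintype.card_fin]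

theorem exists_image_frame_coefficients {r : ℕ} {x₀ : M} {X : Fin r → BigSections I M}
    (hX : ∀ᶠ x in 𝓝 x₀, LinearIndependent ℝ (fun i ↦ τ.apply (X i) x) ∧
      Submodule.span ℝ (Set.range fun i ↦ τ.apply (X i) x) = τ.image x) (s : τ.imageSections) :
    ∃ f : Fin r → C^∞⟮I, M; ℝ⟯, ∀ᶠ x in 𝓝 x₀, τ.ofImage s x = ∑ i, f i x • τ.apply (X i) x :=
  exists_contMDiffMap_coefficients hX.self_of_nhds.1
    (hX.mono fun x hx ↦ hx.2 ▸ τ.ofImage_mem s x)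

theorem isSmoothVectorBundle_imageSections : IsSmoothVectorBundle I τ.imageSections where
  smul_mem f s hs :=
    (f • τ.ofImage ⟨s, hs⟩).contMDiff.congr fun x ↦ by
      rw [map_smul]; rfl
  mem_of_locally s hs x₀ := by
    obtain ⟨t, ht, hst⟩ := hs x₀
    exact (ht x₀).congr_of_eventuallyEq (hst.mono fun x hx ↦ by simp only [hx])
  exists_frame := by
    obtain ⟨r, hr⟩ := τ.const_rank
    refine ⟨r, fun x₀ ↦ ?_⟩
    obtain ⟨X, hX⟩ := τ.exists_image_frame hr x₀
    refine ⟨fun i ↦ (τ.toImage (τ.apply (X i)) (τ.apply_mem (X i))).1,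
      fun i ↦ Subtype.property _, hX.mono fun x hx ↦ ⟨?_, ?_⟩, fun s hs ↦ ?_⟩
    · exact LinearIndependent.of_comp (τ.incl x) hx.1
    · refine Submodule.map_injective_of_injective (τ.incl_injective x) ?_
      rw [Submodule.map_span, ← Set.range_comp, Submodule.map_top, τ.range_incl]
      exact hx.2
    · obtain ⟨f, hf⟩ := τ.exists_image_frame_coefficients hX ⟨s, hs⟩
      refine ⟨f, hf.mono fun x hx ↦ τ.incl_injective x ?_⟩
      simp only [map_sum, map_smul]
      exact hx

theorem exists_apply_eventuallyEq_ofImage (s : τ.imageSections) (x₀ : M) :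
    ∃ X : BigSections I M, ∀ᶠ x in 𝓝 x₀, τ.apply X x = τ.ofImage s x := by
  obtain ⟨r, hr⟩ := τ.const_rank
  obtain ⟨X, hX⟩ := τ.exists_image_frame hr x₀
  obtain ⟨f, hf⟩ := τ.exists_image_frame_coefficients hX s
  refine ⟨⟨fun x ↦ ∑ i, f i x • X i x, ContMDiff.sum_section fun i _ ↦
    ContMDiff.smul_section (f i).contMDiff (X i).contMDiff⟩, hf.mono fun x hx ↦ ?_⟩
  rw [hx, apply_apply]
  change τ.toFun x (∑ i, f i x • X i x) = _
  simp only [map_sum, map_smul, apply_apply]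

theorem exists_apply_eq_ofImage (s : τ.imageSections) :
    ∃ X : BigSections I M, τ.apply X = τ.ofImage s := by
  obtain ⟨X, hX⟩ := exists_contMDiffSection_forall_mem_convex_of_local I (n := ⊤)
    (F_fiber := BigModel E) (fun x : M ↦ BigTangentSpace I x)
    (fun x ↦ {v | τ.toFun x v = τ.ofImage s x})
    (fun x ↦ (convex_singleton (τ.ofImage s x)).linear_preimage (τ.toFun x))
    (fun x₀ ↦ by
      obtain ⟨X, hX⟩ := τ.exists_apply_eventuallyEq_ofImage s x₀
      exact ⟨_, hX, X, X.contMDiff.contMDiffOn, fun y hy ↦ hy⟩)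
  exact ⟨X, by ext x : 1; exact hX x⟩

end TwoNilpotentStructure

end ImageBundle

section Transfer

variable {E : Type*} [NormedAddCommGroup E] [NormedSpace ℝ E]
  {H : Type*} [TopologicalSpace H] {I : ModelWithCorners ℝ E H}
  {M : Type*} [TopologicalSpace M] [ChartedSpace H M]
  {V : M → Type*} [∀ x, AddCommGroup (V x)] [∀ x, Module ℝ (V x)]
  {V' : M → Type*} [∀ x, AddCommGroup (V' x)] [∀ x, Module ℝ (V' x)]
  {Γ : Submodule ℝ (Π x : M, V x)} {Γ' : Submodule ℝ (Π x : M, V' x)}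
  {φ : Π x : M, V x ≃ₗ[ℝ] V' x}

theorem IsSmoothVectorBundle.of_equiv (hφ : ∀ s : Π x : M, V x, s ∈ Γ ↔ (fun x ↦ φ x (s x)) ∈ Γ')
    (h : IsSmoothVectorBundle I Γ') : IsSmoothVectorBundle I Γ where
  smul_mem f s hs := by
    rw [hφ] at hs ⊢
    simpa only [map_smul] using h.smul_mem f _ hs
  mem_of_locally s hs := by
    rw [hφ]
    refine h.mem_of_locally _ fun x₀ ↦ ?_
    obtain ⟨t, ht, hst⟩ := hs x₀
    exact ⟨_, (hφ t).1 ht, hst.mono fun x hx ↦ congrArg (φ x) hx⟩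
  exists_frame := by
    obtain ⟨k, hk⟩ := h.exists_frame
    refine ⟨k, fun x₀ ↦ ?_⟩
    obtain ⟨e, he, h_frame, h_coeff⟩ := hk x₀
    refine ⟨fun i x ↦ (φ x).symm (e i x), fun i ↦ by simpa [hφ] using he i,
      h_frame.mono fun x hx ↦ ⟨hx.1.map' _ (φ x).symm.ker, ?_⟩, fun s hs ↦ ?_⟩
    · have h_span := Submodule.map_span ((φ x).symm : V' x →ₗ[ℝ] V x) (Set.range fun i ↦ e i x)
      rw [hx.2, Submodule.map_top, LinearEquiv.range, ← Set.range_comp] at h_span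
      exact h_span.symm
    · obtain ⟨f, hf⟩ := h_coeff _ ((hφ s).1 hs)
      exact ⟨f, hf.mono fun x hx ↦ by simpa using congrArg (φ x).symm hx⟩

namespace IsLieAlgebroidIso

variable {br : Γ → Γ → Π x : M, V x} {ρ : Π x : M, V x →ₗ[ℝ] TangentSpace I x}
  {br' : Γ' → Γ' → Π x : M, V' x} {ρ' : Π x : M, V' x →ₗ[ℝ] TangentSpace I x}

/-- The map `s ↦ φ ∘ s` on sections induced by an isomorphism `φ` of Lie algebroids. -/
def sectionMap (hφ : IsLieAlgebroidIso I Γ br ρ Γ' br' ρ' φ) : Γ →ₗ[ℝ] Γ' where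
  toFun s := ⟨fun x ↦ φ x (s.1 x), (hφ.mem_iff s.1).1 s.2⟩
  map_add' _ _ := Subtype.ext (funext fun x ↦ map_add (φ x) _ _)
  map_smul' _ _ := Subtype.ext (funext fun x ↦ map_smul (φ x) _ _)

variable (hφ : IsLieAlgebroidIso I Γ br ρ Γ' br' ρ' φ)
include hφ

theorem map_bracket_apply (s t : Γ) (x : M) :
    φ x (br s t x) = br' (hφ.sectionMap s) (hφ.sectionMap t) x := hφ.map_bracket s t x

theorem bracket_mem (h' : ∀ s t, br' s t ∈ Γ') (s t : Γ) : br s t ∈ Γ := by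
  rw [hφ.mem_iff, funext (hφ.map_bracket_apply s t)]
  exact h' _ _

theorem sectionMap_bracket (h' : ∀ s t, br' s t ∈ Γ') (s t : Γ) :
    hφ.sectionMap ⟨br s t, hφ.bracket_mem h' s t⟩ =
      ⟨br' (hφ.sectionMap s) (hφ.sectionMap t), h' _ _⟩ :=
  Subtype.ext (funext (hφ.map_bracket_apply s t))

theorem isLieAlgebroid [IsManifold I ∞ M] (h : IsLieAlgebroid I Γ' br' ρ') :
    IsLieAlgebroid I Γ br ρ where
  isSmoothVectorBundle := h.isSmoothVectorBundle.of_equiv hφ.mem_iff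
  anchor_smooth s := (h.anchor_smooth (hφ.sectionMap s)).congr fun x ↦
    congrArg _ (hφ.map_anchor x _).symm
  bracket_mem := hφ.bracket_mem h.bracket_mem
  bracket_add s t u := funext fun x ↦ (φ x).injective <| by
    simp only [Pi.add_apply, map_add, hφ.map_bracket_apply, h.bracket_add]
  bracket_smul c s t := funext fun x ↦ (φ x).injective <| by
    simp only [Pi.smul_apply, map_smul, hφ.map_bracket_apply, h.bracket_smul]
  bracket_skew s t := funext fun x ↦ (φ x).injective <| by
    rw [Pi.neg_apply, map_neg, hφ.map_bracket_apply, hφ.map_bracket_apply, h.bracket_skew]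
    rfl
  jacobi s t u := funext fun x ↦ (φ x).injective <| by
    simp only [Pi.add_apply, Pi.zero_apply, map_add, map_zero, hφ.map_bracket_apply,
      hφ.sectionMap_bracket h.bracket_mem]
    exact congrFun (h.jacobi _ _ _) x
  leibniz s t f x := (φ x).injective <| by
    have h_smul (ht : (fun y ↦ f y • t.1 y) ∈ Γ) : hφ.sectionMap ⟨_, ht⟩ =
        ⟨_, h.isSmoothVectorBundle.smul_mem f _ (hφ.sectionMap t).2⟩ :=
      Subtype.ext (funext fun y ↦ map_smul (φ y) _ _)
    rw [map_add, map_smul, map_smul, hφ.map_bracket_apply, hφ.map_bracket_apply,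
      ← hφ.map_anchor, h_smul]
    exact h.leibniz _ _ f x
  anchor_bracket s t x := by
    rw [← hφ.map_anchor, hφ.map_bracket_apply, h.anchor_bracket]
    simp only [← hφ.map_anchor]
    rfl

end IsLieAlgebroidIso

end Transfer

section Integrability

variable {E : Type*} [NormedAddCommGroup E] [NormedSpace ℝ E]
  {H : Type*} [TopologicalSpace H] {I : ModelWithCorners ℝ E H}
  {M : Type*} [TopologicalSpace M] [ChartedSpace H M] [IsManifold I ∞ M]

namespace TwoNilpotentStructure

open BigSections

variable (τ : TwoNilpotentStructure I M)

theorem metric_apply_left (X Y : BigSections I M) :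
    metric (τ.apply X) Y = -metric X (τ.apply Y) := by
  ext x
  exact eq_neg_of_add_eq_zero_right (τ.skew x (X x) (Y x))

theorem apply_ofImage (s : τ.imageSections) : τ.apply (τ.ofImage s) = 0 := by
  ext x : 1
  obtain ⟨v, hv⟩ := τ.ofImage_mem s x
  rw [apply_apply, ← hv, τ.sq_zero]
  rfl

theorem proj_eq_proj_iff {x : M} {v w : BigTangentSpace I x} :
    τ.proj x v = τ.proj x w ↔ τ.toFun x v = τ.toFun x w := by
  rw [← tauPrime_mk, ← tauPrime_mk, (τ.incl_injective x).eq_iff, (τ.tauPrime x).injective.eq_iff]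

theorem mkQuot_eq_mkQuot_iff {X Y : BigSections I M} :
    τ.mkQuot X = τ.mkQuot Y ↔ τ.apply X = τ.apply Y := by
  simp only [Subtype.ext_iff, funext_iff, ContMDiffSection.ext_iff]
  exact forall_congr' fun x ↦ τ.proj_eq_proj_iff

variable [FiniteDimensional ℝ E]

theorem courantNijenhuis_eq_zero_iff {X Y : BigSections I M} {x : M} :
    τ.courantNijenhuis X Y x = 0 ↔
      courantBracket (τ.apply X) (τ.apply Y) x = τ.toFun x (τ.tauBracket X Y x) := by
  rw [courantNijenhuis, τ.sq_zero, add_zero, sub_sub, sub_eq_zero, tauBracket, map_add, add_comm]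

variable {τ} in
theorem incl_tauPrime_quotBracket_mkQuot (hτ : τ.IsWeaklyIntegrable) (X Y : BigSections I M)
    (x : M) : τ.incl x (τ.tauPrime x (τ.quotBracket hτ (τ.mkQuot X) (τ.mkQuot Y) x)) =
      courantBracket (τ.apply X) (τ.apply Y) x := by
  rw [quotBracket, LinearEquiv.apply_symm_apply]
  rfl

variable [T2Space M] [SigmaCompactSpace M]

theorem metric_ofImage_eq_zero (s : τ.imageSections) {U : BigSections I M} (hU : τ.apply U = 0) :
    metric (τ.ofImage s) U = 0 := by
  obtain ⟨X, hX⟩ := τ.exists_apply_eq_ofImage s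
  rw [← hX, metric_apply_left, hU, metric_zero, neg_zero]

theorem tauBracket_apply (X Y : BigSections I M) (x : M) : τ.tauBracket X Y x =
    (BigSections.courant X (τ.apply Y) - BigSections.courant Y (τ.apply X)) x := by
  rw [BigSections.courant_skew Y, sub_neg_eq_add, add_comm]
  rfl

variable {τ}

theorem IsIntegrable.isWeaklyIntegrable (h : τ.IsIntegrable) : τ.IsWeaklyIntegrable := by
  intro s t x
  obtain ⟨X, hX⟩ := τ.exists_apply_eq_ofImage s
  obtain ⟨Y, hY⟩ := τ.exists_apply_eq_ofImage t
  exact ⟨τ.tauBracket X Y x, by rw [← hX, ← hY, τ.courantNijenhuis_eq_zero_iff.1 (h X Y x)]⟩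

namespace IsWeaklyIntegrable

variable (hτ : τ.IsWeaklyIntegrable)
include hτ

/-- The Courant bracket of two sections of `E`, as a smooth section of `E`. -/
def courant (s t : τ.imageSections) : τ.imageSections :=
  τ.toImage (BigSections.courant (τ.ofImage s) (τ.ofImage t)) (hτ s t)

theorem ofImage_courant (s t : τ.imageSections) :
    τ.ofImage (hτ.courant s t) = BigSections.courant (τ.ofImage s) (τ.ofImage t) := rfl

theorem apply_courant_ofImage {U : BigSections I M} (hU : τ.apply U = 0) (s : τ.imageSections) :
    τ.apply (BigSections.courant U (τ.ofImage s)) = 0 := by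
  refine eq_zero_of_forall_metric_eq_zero fun W ↦ ?_
  let t := τ.toImage (τ.apply W) (τ.apply_mem W)
  have h_metric : metric (τ.ofImage t) (BigSections.courant U (τ.ofImage s)) = 0 := by
    rw [metric_comm, metric_courant_cyclic ((metric_comm _ _).trans (τ.metric_ofImage_eq_zero s hU))
      (τ.metric_ofImage_eq_zero s (τ.apply_ofImage t)) (τ.metric_ofImage_eq_zero t hU),
      ← hτ.ofImage_courant, τ.metric_ofImage_eq_zero _ hU]
  exact neg_eq_zero.1 ((τ.metric_apply_left W _).symm.trans h_metric)

theorem apply_courant_congr {U U' : BigSections I M} (hU : τ.apply U = τ.apply U')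
    (s : τ.imageSections) : τ.apply (BigSections.courant U (τ.ofImage s)) =
      τ.apply (BigSections.courant U' (τ.ofImage s)) := by
  rw [← sub_eq_zero, ← apply_sub, ← sub_courant]
  exact hτ.apply_courant_ofImage (by rw [apply_sub, hU, sub_self]) s

theorem toFun_tauBracket_congr {X X' Y Y' : BigSections I M} (hX : τ.apply X = τ.apply X')
    (hY : τ.apply Y = τ.apply Y') (x : M) :
    τ.toFun x (τ.tauBracket X Y x) = τ.toFun x (τ.tauBracket X' Y' x) := by
  have h_left := hτ.apply_courant_congr hX (τ.toImage (τ.apply Y) (τ.apply_mem Y))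
  have h_right := hτ.apply_courant_congr hY (τ.toImage (τ.apply X) (τ.apply_mem X))
  have h_apply : τ.apply (BigSections.courant X (τ.apply Y) - BigSections.courant Y (τ.apply X)) =
      τ.apply (BigSections.courant X' (τ.apply Y') - BigSections.courant Y' (τ.apply X')) := by
    rw [apply_sub, apply_sub, ← hX, ← hY]
    exact congrArg₂ (· - ·) h_left h_right
  rw [τ.tauBracket_apply, τ.tauBracket_apply]
  exact congrArg (fun A : BigSections I M ↦ A x) h_apply

end IsWeaklyIntegrable

theorem inducedBracket_mkQuot (hτ : τ.IsWeaklyIntegrable) (X Y : BigSections I M) (x : M) :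
    τ.inducedBracket (τ.mkQuot X) (τ.mkQuot Y) x = τ.proj x (τ.tauBracket X Y x) := by
  have h_repr (Z : BigSections I M) :
      τ.apply (τ.exists_mkQuot_eq (τ.mkQuot Z)).choose = τ.apply Z :=
    τ.mkQuot_eq_mkQuot_iff.1 (τ.exists_mkQuot_eq (τ.mkQuot Z)).choose_spec
  exact τ.proj_eq_proj_iff.2 (hτ.toFun_tauBracket_congr (h_repr X) (h_repr Y) x)

theorem isIntegrable_iff (hτ : τ.IsWeaklyIntegrable) :
    τ.IsIntegrable ↔ τ.inducedBracket = τ.quotBracket hτ := by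
  have h_torsion (X Y : BigSections I M) (x : M) : τ.courantNijenhuis X Y x = 0 ↔
      τ.inducedBracket (τ.mkQuot X) (τ.mkQuot Y) x =
        τ.quotBracket hτ (τ.mkQuot X) (τ.mkQuot Y) x := by
    rw [inducedBracket_mkQuot hτ, courantNijenhuis_eq_zero_iff,
      ← incl_tauPrime_quotBracket_mkQuot hτ, ← tauPrime_mk, (τ.incl_injective x).eq_iff,
      (τ.tauPrime x).injective.eq_iff, eq_comm]
  refine ⟨fun h ↦ ?_, fun h X Y x ↦ (h_torsion X Y x).2 (by rw [h])⟩
  funext s t x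
  obtain ⟨X, rfl⟩ := τ.exists_mkQuot_eq s
  obtain ⟨Y, rfl⟩ := τ.exists_mkQuot_eq t
  exact (h_torsion X Y x).1 (h X Y x)

theorem isLieAlgebroid_image (hτ : τ.IsWeaklyIntegrable) :
    IsLieAlgebroid I τ.imageSections (τ.imageBracket hτ) τ.imageAnchor where
  isSmoothVectorBundle := τ.isSmoothVectorBundle_imageSections
  anchor_smooth s := (τ.ofImage s).vec.contMDiff
  bracket_mem s t := (hτ.courant s t).2
  bracket_add s t u :=
    have h : hτ.courant s (t + u) = hτ.courant s t + hτ.courant s u :=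
      τ.ofImage_injective (courant_add (τ.ofImage s) (τ.ofImage t) (τ.ofImage u))
    congrArg Subtype.val h
  bracket_smul c s t :=
    have h : hτ.courant s (c • t) = c • hτ.courant s t :=
      τ.ofImage_injective (courant_smul (τ.ofImage s) (τ.ofImage t) c)
    congrArg Subtype.val h
  bracket_skew s t :=
    have h : hτ.courant s t = -hτ.courant t s :=
      τ.ofImage_injective (courant_skew (τ.ofImage s) (τ.ofImage t))
    congrArg Subtype.val h
  jacobi s t u :=
    have h_isotropic (a b) : metric (τ.ofImage a) (τ.ofImage b) = 0 :=
      τ.metric_ofImage_eq_zero a (τ.apply_ofImage b)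
    have h : hτ.courant s (hτ.courant t u) + hτ.courant t (hτ.courant u s)
        + hτ.courant u (hτ.courant s t) = 0 :=
      τ.ofImage_injective (courant_jacobi (h_isotropic s t) (h_isotropic t u) (h_isotropic u s)
        (h_isotropic s (hτ.courant t u)) (h_isotropic t (hτ.courant u s))
        (h_isotropic u (hτ.courant s t)))
    congrArg Subtype.val h
  leibniz s t f x := τ.incl_injective x <| by
    have h := courant_smul_coe (τ.metric_ofImage_eq_zero s (τ.apply_ofImage t)) f
    rw [map_add, map_smul, map_smul]
    exact congrArg (fun A : BigSections I M ↦ A x) h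
  anchor_bracket _ _ _ := rfl

theorem isLieAlgebroidIso_tauPrime (hτ : τ.IsWeaklyIntegrable) :
    IsLieAlgebroidIso I τ.quotSections (τ.quotBracket hτ) τ.quotAnchor τ.imageSections
      (τ.imageBracket hτ) τ.imageAnchor τ.tauPrime where
  mem_iff s := by
    refine ⟨fun hs ↦ (τ.tauPrimeSection ⟨s, hs⟩).2, fun hs ↦ ?_⟩
    obtain ⟨X, hX⟩ := τ.exists_apply_eq_ofImage ⟨_, hs⟩
    have h_eq : s = (τ.mkQuot X).1 := funext fun x ↦
      (τ.tauPrime x).injective (τ.incl_injective x (congrArg (fun A ↦ A x) hX).symm)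
    exact h_eq ▸ (τ.mkQuot X).2
  map_anchor _ _ := rfl
  map_bracket _ _ x := (τ.tauPrime x).apply_symm_apply _

end TwoNilpotentStructure

end Integrability

end

end BigTangent

open BigTangent.TwoNilpotentStructure in
theorem proposition4p2_general {E : Type*} [NormedAddCommGroup E] [NormedSpace ℝ E]
    [FiniteDimensional ℝ E] {H : Type*} [TopologicalSpace H] (I : ModelWithCorners ℝ E H)
    (M : Type*) [TopologicalSpace M] [ChartedSpace H M] [IsManifold I ∞ M]
    [T2Space M] [SigmaCompactSpace M]
    (τ : BigTangent.TwoNilpotentStructure I M) :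
    (τ.IsWeaklyIntegrable → ∀ (X Y : BigTangent.BigSections I M) (x : M),
      τ.inducedBracket (τ.mkQuot X) (τ.mkQuot Y) x =
        τ.proj x (τ.tauBracket X Y x)) ∧
    (τ.IsIntegrable → ∃ hτ : τ.IsWeaklyIntegrable,
      BigTangent.IsLieAlgebroid I τ.quotSections τ.inducedBracket τ.quotAnchor ∧
      BigTangent.IsLieAlgebroid I τ.imageSections
        (τ.imageBracket hτ) τ.imageAnchor ∧
      BigTangent.IsLieAlgebroidIso I τ.quotSections τ.inducedBracket τ.quotAnchor
        τ.imageSections (τ.imageBracket hτ) τ.imageAnchor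
        τ.tauPrime) ∧
    (∀ hτ : τ.IsWeaklyIntegrable,
      τ.IsIntegrable ↔
        τ.inducedBracket = τ.quotBracket hτ) := by
  refine ⟨fun hτ ↦ inducedBracket_mkQuot hτ, fun h ↦ ?_, fun hτ ↦ isIntegrable_iff hτ⟩
  have hτ := h.isWeaklyIntegrable
  have hE := isLieAlgebroid_image hτ
  have hφ := isLieAlgebroidIso_tauPrime hτ
  refine ⟨hτ, ?_⟩
  rw [(isIntegrable_iff hτ).1 h]
  exact ⟨hφ.isLieAlgebroid hE, hE, hφ⟩

theorem proposition4p2 {E : Type*} [NormedAddCommGroup E] [NormedSpace ℝ E]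
    [FiniteDimensional ℝ E] {H : Type*} [TopologicalSpace H] (I : ModelWithCorners ℝ E H)
    (M : Type*) [TopologicalSpace M] [ChartedSpace H M] [IsManifold I ∞ M]
    [BoundarylessManifold I M] [T2Space M] [SigmaCompactSpace M]
    (τ : BigTangent.TwoNilpotentStructure I M) :
    -- for weakly integrable `τ`, the induced `τ`-bracket is well defined
    (τ.IsWeaklyIntegrable → ∀ (X Y : BigTangent.BigSections I M) (x : M),
      τ.inducedBracket (τ.mkQuot X) (τ.mkQuot Y) x =
        τ.proj x (τ.tauBracket X Y x)) ∧
    -- first part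
    (τ.IsIntegrable → ∃ hτ : τ.IsWeaklyIntegrable,
      BigTangent.IsLieAlgebroid I τ.quotSections τ.inducedBracket τ.quotAnchor ∧
      BigTangent.IsLieAlgebroid I τ.imageSections
        (τ.imageBracket hτ) τ.imageAnchor ∧
      BigTangent.IsLieAlgebroidIso I τ.quotSections τ.inducedBracket τ.quotAnchor
        τ.imageSections (τ.imageBracket hτ) τ.imageAnchor
        τ.tauPrime) ∧
    -- second part
    (∀ hτ : τ.IsWeaklyIntegrable,
      τ.IsIntegrable ↔
        τ.inducedBracket = τ.quotBracket hτ) :=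
  proposition4p2_general I M τ
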